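/- Let $X$ be a real Banach space and $C\subset X$ an arbitrary subset. For a free ultrafilter $\mathcal U$ on an infinite set $I$, let $X^{\mathcal U}$ be the ultrapower, i.e. the quotient of $\ell_\infty(I,X)$ (bounded families, sup norm) by the closed subspace of the families with $\lim_{i,\mathcal U}\|x_i\|=0$, and let $C^{\mathcal U}\subset X^{\mathcal U}$ be the set of classes of bounded families $(x_i)_{i\in I}$ with $x_i\in C$ for all $i$. The set $C$ is called relatively super weakly compact if, for every free ultrafilter $\mathcal U$ on an infinite set, the closure of $C^{\mathcal U}$ in the weak topology of $X^{\mathcal U}$ is weakly compact. Then $C$ is not relatively super weakly compact if and only if there exists $\theta>0$ such that for every $n\in\mathbb N$ there is a map $f_n:\{0,1\}^n\to C$ such that, for every $1\le k\le n$ and every $(a_1,\dots,a_{k-1})\in\{0,1\}^{k-1}$, $$\operatorname{dist}\big(\operatorname{conv} f_n(A_0),\,\operatorname{conv} f_n(A_1)\big)\ge\theta,\qquad A_\varepsilon=\{(a_1,\dots,a_{k-1},\varepsilon)\}\times\{0,1\}^{n-k}\quad(\varepsilon=0,1),$$ where $\operatorname{dist}(A,B)=\inf\{\|x-y\|:x\in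 A,\ y\in B\}$. -/

import Mathlib

universe u w

section Ultrapower

variable {I : Type w} (U : Ultrafilter I) (X : Type u) [NormedAddCommGroup X] [NormedSpace ℝ X]

/-- The subspace of `ℓ_∞(I, X)` of the bounded families `(x_i)` with `lim_U ‖x_i‖ = 0`. -/
def ultraNull : Submodule ℝ (lp (fun _ : I => X) ⊤) where
  carrier := {x | Filter.Tendsto (fun i => ‖x i‖) (U : Filter I) (nhds 0)}
  zero_mem' := by simp
  add_mem' := by
    intro x y hx hy
    refine squeeze_zero (fun i => norm_nonneg _) (fun i => ?_) (by simpa using Filter.Tendsto.add hx hy)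
    simpa using norm_add_le (x i) (y i)
  smul_mem' := by
    intro c x hx
    have h : Filter.Tendsto (fun i => ‖c‖ * ‖x i‖) (U : Filter I) (nhds 0) := by
      simpa using Filter.Tendsto.const_mul ‖c‖ hx
    simpa [norm_smul] using h

/-- The null subspace is closed, so that the quotient by it is a normed space. -/
instance ultraNull_isClosed : IsClosed (ultraNull U X : Set (lp (fun _ : I => X) ⊤)) := by
  refine isClosed_of_closure_subset fun x hx => ?_
  change Filter.Tendsto (fun i => ‖x i‖) (U : Filter I) (nhds 0)
  rw [Metric.tendsto_nhds]
  intro ε hε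
  obtain ⟨y, hy, hxy⟩ := Metric.mem_closure_iff.1 hx (ε / 2) (half_pos hε)
  have hy' : Filter.Tendsto (fun i => ‖y i‖) (U : Filter I) (nhds 0) := hy
  filter_upwards [Metric.tendsto_nhds.1 hy' (ε / 2) (half_pos hε)] with i hi
  have h1 : ‖x i - y i‖ ≤ ‖x - y‖ := lp.norm_apply_le_norm ENNReal.top_ne_zero (x - y) i
  rw [dist_eq_norm] at hxy
  rw [Real.dist_eq, sub_zero, abs_norm] at hi ⊢
  have h2 : ‖x i‖ ≤ ‖x i - y i‖ + ‖y i‖ := by simpa using norm_add_le (x i - y i) (y i)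
  linarith

/-- The ultrapower `X^U`, with the quotient norm of `ℓ_∞(I, X)`. -/
abbrev BanachUltrapower : Type (max u w) := lp (fun _ : I => X) ⊤ ⧸ ultraNull U X

variable {X}

/-- `C^U`: the classes in `X^U` of the bounded families `(x_i)` with `x_i ∈ C` for all `i`. -/
def ultrapowerSet (C : Set X) : Set (BanachUltrapower U X) :=
  (ultraNull U X).mkQ '' {x | ∀ i, x i ∈ C}

end Ultrapower

/-- `S` is relatively weakly compact: its closure in the weak topology is weakly compact. -/
def IsRelWeaklyCompact {E : Type*} [NormedAddCommGroup E] [NormedSpace ℝ E] (S : Set E) : Prop :=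
  IsCompact (closure (toWeakSpace ℝ E '' S))

/-- `C` is relatively super weakly compact: `C^U` is relatively weakly compact in `X^U` for every
free ultrafilter `U` on every set `I` of the universe `w` (`U` is free if it contains all cofinite
sets; this forces `I` to be infinite). -/
def IsRelSuperWeaklyCompact {X : Type u} [NormedAddCommGroup X] [NormedSpace ℝ X]
    (C : Set X) : Prop :=
  ∀ (I : Type w) (U : Ultrafilter I), (U : Filter I) ≤ Filter.cofinite →
    IsRelWeaklyCompact (ultrapowerSet U C)

/-- The distance `inf {‖x - y‖ : x ∈ A, y ∈ B}` of two nonempty sets. -/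
noncomputable def setDist {X : Type*} [PseudoMetricSpace X] (A B : Set X) : ℝ :=
  sInf (Set.image2 dist A B)

/-- For a prefix `a` of length `k < n` and a digit `ε`, the subcube `(a, ε) × {0,1}^(n-k-1)` of
`{0,1}^n`. -/
def subcube {n : ℕ} (k : Fin n) (a : Fin k → Bool) (ε : Bool) : Set (Fin n → Bool) :=
  {b | (∀ j : Fin k, b (Fin.castLE k.isLt.le j) = a j) ∧ b k = ε}

open Filter Topology NormedSpace


/-! ### Weak compactness, dyadic trees and James sequences -/

section WeakTopology

variable {E : Type*} [NormedAddCommGroup E] [NormedSpace ℝ E]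

/-! From cubes to failure of compactness: the cubes glue, coordinate by coordinate, to an infinite
`θ`-separated tree in `C^U` indexed by `Set ℕ`. Were `C^U` relatively weakly compact, each branch
would have a weak limit of its finite truncations. By Mazur, limits of distinct branches stay `θ`
apart, yet all lie in the closed span of countably many points; there are uncountably many branches
(`not_isRelWeaklyCompact_of_tree`).

Conversely, if a functional is unbounded on `C`, a sequence along which it grows fast enough
suffices. Otherwise `C` is bounded and some `C^U` has a weak* limit in the bidual at positive
distance from `X^U`; Helly's condition yields James sequences (`exists_separated_sequence`).
Compactness of the simplex brings the separation of finitely many points down to one coordinate, and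
lexicographic order lays `2 ^ n` points on the cube (`exists_cube_of_sequence`). -/

lemma mem_closure_convexHull_of_mem_weak_closure {A : Set E} {y : E}
    (hy : toWeakSpace ℝ E y ∈ closure (toWeakSpace ℝ E '' A)) :
    y ∈ closure (convexHull ℝ A) := by
  have h := closure_mono (Set.image_mono (subset_convexHull ℝ A)) hy
  -- Mazur: a convex set has the same weak and norm closure.
  rw [← (convex_convexHull ℝ A).toWeakSpace_closure ℝ] at h
  exact (toWeakSpace ℝ E).injective.mem_set_image.1 h

lemma le_dist_of_mem_weak_closure {A B : Set E} {θ : ℝ}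
    (h : ∀ y ∈ convexHull ℝ A, ∀ z ∈ convexHull ℝ B, θ ≤ dist y z) {y z : E}
    (hy : toWeakSpace ℝ E y ∈ closure (toWeakSpace ℝ E '' A))
    (hz : toWeakSpace ℝ E z ∈ closure (toWeakSpace ℝ E '' B)) : θ ≤ dist y z := by
  have hmem : (y, z) ∈ closure (convexHull ℝ A ×ˢ convexHull ℝ B) := by
    rw [closure_prod_eq]
    exact ⟨mem_closure_convexHull_of_mem_weak_closure hy,
      mem_closure_convexHull_of_mem_weak_closure hz⟩
  have hcl : IsClosed {p : E × E | θ ≤ dist p.1 p.2} := isClosed_le continuous_const continuous_dist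
  exact closure_minimal (fun p hp => h p.1 hp.1 p.2 hp.2) hcl hmem

/-- A separable set contains no uncountable uniformly separated family. -/
lemma not_isSeparable_of_separated {M : Type*} [PseudoMetricSpace M] {S : Set M} {θ : ℝ}
    (hθ : 0 < θ) {y : Set ℕ → M} (hy : ∀ b, y b ∈ S)
    (hsep : ∀ b c, b ≠ c → θ ≤ dist (y b) (y c)) : ¬ TopologicalSpace.IsSeparable S := by
  rintro ⟨T, hT, hST⟩
  have h : ∀ b, ∃ t : T, dist (y b) t < θ / 2 := fun b => by
    obtain ⟨t, ht, htd⟩ := Metric.mem_closure_iff.1 (hST (hy b)) (θ / 2) (half_pos hθ)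
    exact ⟨⟨t, ht⟩, htd⟩
  choose t ht using h
  have hinj : Function.Injective t := by
    intro b c hbc
    by_contra hne
    have h1 := ht b
    have h2 := ht c
    rw [← hbc] at h2
    have h3 := dist_triangle_right (y b) (y c) (t b : M)
    linarith [hsep b c hne]
  have : Countable T := hT.to_subtype
  obtain ⟨e, he⟩ := exists_injective_nat T
  have hinj' := he.comp hinj
  exact Function.cantor_injective _ hinj'

/-- The infinite dyadic tree of convex hulls, indexed by the subsets of `ℕ` and separated at every
level by `θ`, does not live in a relatively weakly compact set. -/
lemma not_isRelWeaklyCompact_of_tree {D : Set E} {θ : ℝ} (hθ : 0 < θ) {F : Set ℕ → E}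
    (hF : ∀ b, F b ∈ D)
    (hsep : ∀ (k : ℕ) (s : Set ℕ),
      ∀ y ∈ convexHull ℝ (F '' {b | (∀ j < k, j ∈ b ↔ j ∈ s) ∧ k ∉ b}),
      ∀ z ∈ convexHull ℝ (F '' {b | (∀ j < k, j ∈ b ↔ j ∈ s) ∧ k ∈ b}), θ ≤ dist y z) :
    ¬ IsRelWeaklyCompact D := by
  intro hD
  -- Truncations are finite sets, hence countably many, and eventually agree with `b` on any initial
  -- segment.
  let q : Set ℕ → ℕ → Set ℕ := fun b n => {j | j < n ∧ j ∈ b}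
  have hlim : ∀ b, ∃ y : E, Tendsto (fun n => toWeakSpace ℝ E (F (q b n)))
      (hyperfilter ℕ : Filter ℕ) (𝓝 (toWeakSpace ℝ E y)) := by
    intro b
    obtain ⟨y, -, hy⟩ := hD.ultrafilter_le_nhds'
      ((hyperfilter ℕ).map fun n => toWeakSpace ℝ E (F (q b n)))
      (Filter.mem_map.2 (univ_mem' fun n => subset_closure ⟨_, hF _, rfl⟩))
    refine ⟨(toWeakSpace ℝ E).symm y, ?_⟩
    rw [LinearEquiv.apply_symm_apply]
    exact hy
  choose y hy using hlim
  have hev : ∀ k : ℕ, ∀ᶠ n in (hyperfilter ℕ : Filter ℕ), k < n := fun k =>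
    Nat.hyperfilter_le_atTop (eventually_gt_atTop k)
  have hmem : ∀ (b : Set ℕ) (A : Set (Set ℕ)), (∀ᶠ n in (hyperfilter ℕ : Filter ℕ), q b n ∈ A) →
      toWeakSpace ℝ E (y b) ∈ closure (toWeakSpace ℝ E '' (F '' A)) := fun b A hA =>
    mem_closure_of_tendsto (hy b) (hA.mono fun n hn => ⟨_, ⟨_, hn, rfl⟩, rfl⟩)
  have hlt : ∀ (b c : Set ℕ) (k : ℕ), (∀ j < k, j ∈ b ↔ j ∈ c) → k ∉ b → k ∈ c →
      θ ≤ dist (y b) (y c) := by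
    intro b c k hbc hb hc
    refine le_dist_of_mem_weak_closure (hsep k b) (hmem b _ ?_) (hmem c _ ?_)
    · exact (hev k).mono fun n hn =>
        ⟨fun j hj => ⟨fun h => h.2, fun h => ⟨hj.trans hn, h⟩⟩, fun h => hb h.2⟩
    · exact (hev k).mono fun n hn =>
        ⟨fun j hj => ⟨fun h => (hbc j hj).2 h.2, fun h => ⟨hj.trans hn, (hbc j hj).1 h⟩⟩, hn, hc⟩
  have hsepy : ∀ b c, b ≠ c → θ ≤ dist (y b) (y c) := by
    classical
    intro b c hbc
    have hex : ∃ k, ¬ (k ∈ b ↔ k ∈ c) := by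
      by_contra h
      push Not at h
      exact hbc (Set.ext h)
    have hmin : ∀ j < Nat.find hex, j ∈ b ↔ j ∈ c := fun j hj => not_not.1 (Nat.find_min hex hj)
    by_cases hb : Nat.find hex ∈ b
    · have hc : Nat.find hex ∉ c := fun hc => Nat.find_spec hex ⟨fun _ => hc, fun _ => hb⟩
      rw [dist_comm]
      exact hlt c b _ (fun j hj => (hmin j hj).symm) hc hb
    · have hc : Nat.find hex ∈ c := by
        by_contra hc
        exact Nat.find_spec hex ⟨fun h => absurd h hb, fun h => absurd h hc⟩
      exact hlt b c _ hmin hb hc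
  have hcount : (F '' {b : Set ℕ | b.Finite}).Countable :=
    (Set.Countable.ofPred_finite (α := ℕ)).image F
  refine not_isSeparable_of_separated hθ (fun b => ?_) hsepy
    ((hcount.isSeparable.span (R := ℝ)).closure)
  have h1 := mem_closure_convexHull_of_mem_weak_closure (hmem b {b | b.Finite}
    (Eventually.of_forall fun n => (Set.finite_lt_nat n).subset fun j hj => hj.1))
  exact closure_mono (convexHull_min Submodule.subset_span (Submodule.convex _)) h1

/-- Uniform boundedness, for points viewed as functionals on the dual; `-g` supplies the lower
bounds. -/
lemma isBounded_of_forall_dual {D : Set E}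
    (hD : ∀ g : StrongDual ℝ E, BddAbove (g '' D)) : Bornology.IsBounded D := by
  have h : ∀ g : StrongDual ℝ E, ∃ c, ∀ x : D, ‖inclusionInDoubleDual ℝ E x g‖ ≤ c := by
    intro g
    obtain ⟨c, hc⟩ := hD g
    obtain ⟨c', hc'⟩ := hD (-g)
    refine ⟨max c c', fun x => ?_⟩
    rw [dual_def, Real.norm_eq_abs, abs_le']
    exact ⟨(hc ⟨x, x.2, rfl⟩).trans (le_max_left _ _), (hc' ⟨x, x.2, rfl⟩).trans (le_max_right _ _)⟩
  obtain ⟨c, hc⟩ := banach_steinhaus h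
  refine isBounded_iff_forall_norm_le.2 ⟨c, fun x hx => ?_⟩
  have := hc ⟨x, hx⟩
  rwa [← (inclusionInDoubleDualLi (E := E) ℝ).norm_map x]

lemma IsRelWeaklyCompact.isBounded {D : Set E} (hD : IsRelWeaklyCompact D) :
    Bornology.IsBounded D := by
  refine isBounded_of_forall_dual fun g => ?_
  have hg : Continuous fun y : WeakSpace ℝ E => g ((toWeakSpace ℝ E).symm y) :=
    WeakBilin.eval_continuous (topDualPairing ℝ E).flip g
  refine (hD.image hg).bddAbove.mono ?_
  rintro _ ⟨x, hx, rfl⟩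
  exact ⟨toWeakSpace ℝ E x, subset_closure ⟨x, hx, rfl⟩, rfl⟩

/-- `Φ` is a weak* limit of `D` outside `E`; `d` exists because the complete space `E` is norm
closed in its bidual. -/
lemma exists_dual_not_mem_range [CompleteSpace E] {D : Set E} (hb : Bornology.IsBounded D)
    (hD : ¬ IsRelWeaklyCompact D) :
    ∃ (Φ : StrongDual ℝ (StrongDual ℝ E)) (d : ℝ), 0 < d ∧
      (∀ x, d ≤ ‖Φ - inclusionInDoubleDual ℝ E x‖) ∧
      ∀ s : Set (StrongDual ℝ E × ℝ), s.Finite → (∀ p ∈ s, p.2 < Φ p.1) →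
        ∃ x ∈ D, ∀ p ∈ s, p.2 < p.1 x := by
  have hn : ¬ closure (inclusionInDoubleDualWeak ℝ E '' (toWeakSpace ℝ E '' D)) ⊆
      Set.range (inclusionInDoubleDualWeak ℝ E) := fun h => by
    refine hD (isCompact_closure_of_isBounded ℝ E _ ?_ h)
    rwa [(toWeakSpace ℝ E).injective.preimage_image]
  obtain ⟨Φ, hΦ, hΦr⟩ := Set.not_subset.1 hn
  have hcl : IsClosed (Set.range (inclusionInDoubleDual ℝ E)) :=
    (inclusionInDoubleDualLi (E := E) ℝ).isometry.isUniformInducing.isComplete_range.isClosed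
  have hΦ' : WeakDual.toStrongDual Φ ∉ Set.range (inclusionInDoubleDual ℝ E) := by
    rintro ⟨x, hx⟩
    exact hΦr ⟨toWeakSpace ℝ E x, hx⟩
  obtain ⟨d, hd, hball⟩ := (Metric.mem_nhds_iff
    (α := StrongDual ℝ (StrongDual ℝ E))).1 (hcl.isOpen_compl.mem_nhds hΦ')
  refine ⟨WeakDual.toStrongDual Φ, d, hd, fun x => ?_, fun s hs hc => ?_⟩
  · by_contra hlt
    push Not at hlt
    exact hball ((mem_ball_iff_norm' (E := StrongDual ℝ (StrongDual ℝ E))).2 hlt) ⟨x, rfl⟩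
  · have hopen : IsOpen (⋂ p ∈ s, {Ψ : WeakDual ℝ (StrongDual ℝ E) | p.2 < Ψ p.1}) :=
      hs.isOpen_biInter fun p _ => isOpen_lt continuous_const (WeakDual.eval_continuous p.1)
    obtain ⟨_, hx, _, ⟨x, hxD, rfl⟩, rfl⟩ := mem_closure_iff.1 hΦ _ hopen (Set.mem_iInter₂.2 hc)
    exact ⟨x, hxD, fun p hp => Set.mem_iInter₂.1 hx p hp⟩

/-- Helly's condition for a functional of the bidual far from `E`, in one-sided form. -/
lemma exists_dual_separating {Φ : StrongDual ℝ (StrongDual ℝ E)} {d θ : ℝ}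
    (hΦ : ∀ x, d ≤ ‖Φ - inclusionInDoubleDual ℝ E x‖) (h0 : 0 ≤ θ) (hθ : θ < d) {ι : Type*} [Fintype ι]
    (x : ι → E) : ∃ g : StrongDual ℝ E, ‖g‖ ≤ 1 ∧ ∀ j, g (x j) + θ < Φ g := by
  classical
  by_contra hcon
  push Not at hcon
  let T : StrongDual ℝ E →ₗ[ℝ] (ι → ℝ) :=
    LinearMap.pi fun j => (Φ - inclusionInDoubleDual ℝ E (x j)).toLinearMap
  have hT : ∀ g j, T g j = Φ g - g (x j) := fun g j => rfl
  let O : Set (ι → ℝ) := {t | ∀ j, θ < t j}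
  have hOeq : O = Set.univ.pi fun _ => Set.Ioi θ := by ext; simp [O]
  have hO : IsOpen O := hOeq ▸ isOpen_set_pi Set.finite_univ fun _ _ => isOpen_Ioi
  have hOc : Convex ℝ O := hOeq ▸ convex_pi fun _ _ => convex_Ioi θ
  have hdisj : Disjoint O (T '' Metric.closedBall 0 1) := by
    rw [Set.disjoint_left]
    rintro _ ht ⟨g, hg, rfl⟩
    obtain ⟨j, hj⟩ := hcon g (by simpa using hg)
    have := ht j
    rw [hT] at this
    linarith
  obtain ⟨f, u, hfO, hfT⟩ := geometric_hahn_banach_open hOc hO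
    ((convex_closedBall (0 : StrongDual ℝ E) 1).linear_image T) hdisj
  have hu : u ≤ 0 := by
    have := hfT (T 0) ⟨0, by simp, rfl⟩
    simpa using this
  have hfsum : ∀ t : ι → ℝ, f t = ∑ j, t j * f (Pi.single j 1) := fun t => by
    conv_lhs => rw [pi_eq_sum_univ' t]
    rw [map_sum]
    refine Finset.sum_congr rfl fun j _ => ?_
    rw [map_smul, smul_eq_mul]
  have hneg : ∀ j, f (Pi.single j 1) ≤ 0 := by
    intro j
    by_contra hpos
    push Not at hpos
    have hlow := hfO (fun _ => θ + 1) (fun _ => by simp)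
    have hr : 0 ≤ -f (fun _ => θ + 1) / f (Pi.single j 1) :=
      div_nonneg (by linarith) hpos.le
    have := hfO ((fun _ => θ + 1) + (-f (fun _ => θ + 1) / f (Pi.single j 1)) • Pi.single j 1)
      (fun i => by
        have : 0 ≤ (Pi.single j (1 : ℝ) : ι → ℝ) i := by
          rw [Pi.single_apply]; split_ifs <;> norm_num
        have := mul_nonneg hr this
        simp only [Pi.add_apply, Pi.smul_apply, smul_eq_mul]
        linarith)
    rw [map_add, map_smul, smul_eq_mul, div_mul_cancel₀ _ hpos.ne'] at this
    linarith
  have hconst : ∀ r : ℝ, f (fun _ => r) = r * ∑ j, f (Pi.single j 1) := fun r => by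
    rw [hfsum, Finset.mul_sum]
  set S : ℝ := -∑ j, f (Pi.single j 1) with hS
  have hSpos : 0 < S := by
    have h1 := hfO (fun _ => θ + 1) (fun _ => by simp)
    rw [hconst] at h1
    by_contra hS0
    have := mul_nonneg (by linarith : 0 ≤ θ + 1) (by linarith : 0 ≤ ∑ j, f (Pi.single j 1))
    linarith
  have hθu : -(θ * S) ≤ u := by
    by_contra hlt
    push Not at hlt
    -- Chosen so that `f` takes the forbidden value `u` at a constant vector of `O`.
    have hr : 0 < (-(θ * S) - u) / S := div_pos (by linarith) hSpos
    have h1 := hfO (fun _ => θ + (-(θ * S) - u) / S) (fun _ => by simpa using hr)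
    rw [hconst, ← neg_neg (∑ j, f (Pi.single j 1)), ← hS] at h1
    have h2 : (-(θ * S) - u) / S * S = -(θ * S) - u := div_mul_cancel₀ _ hSpos.ne'
    nlinarith
  -- The weights sum to `1`, so `f (T g)` is `-S * (Φ g - g v)`.
  set v : E := ∑ j, (-f (Pi.single j 1) / S) • x j with hv
  have hkey : ∀ g : StrongDual ℝ E, ‖g‖ ≤ 1 → Φ g - g v ≤ θ := by
    intro g hg
    have h1 := hfT (T g) ⟨g, by simpa using hg, rfl⟩
    have h2 : f (T g) = -S * (Φ g - g v) := by
      rw [hfsum, hv, map_sum, mul_sub, Finset.mul_sum, hS, neg_neg, Finset.sum_mul,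
        ← Finset.sum_sub_distrib]
      refine Finset.sum_congr rfl fun j _ => ?_
      rw [hT, map_smul, smul_eq_mul, ← hS]
      have : (∑ j, f (Pi.single j 1)) = -S := by rw [hS, neg_neg]
      rw [this]
      field_simp
    rw [h2] at h1
    by_contra hlt
    push Not at hlt
    have := mul_lt_mul_of_pos_left hlt hSpos
    linarith
  have hnorm : ‖Φ - inclusionInDoubleDual ℝ E v‖ ≤ θ := by
    refine ContinuousLinearMap.opNorm_le_of_unit_norm h0 fun g hg => ?_
    rw [Real.norm_eq_abs, abs_le']
    have h1 := hkey g hg.le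
    have h2 := hkey (-g) (by rw [norm_neg, hg])
    simp only [map_neg, neg_apply, sub_apply,
      dual_def] at h2 ⊢
    exact ⟨h1, by linarith⟩
  linarith [hΦ v]

/-- James' criterion: a bounded set that is not relatively weakly compact contains long sequences
whose initial segments are uniformly separated from the corresponding final segments by functionals
of norm at most one. -/
lemma exists_separated_sequence [CompleteSpace E] {D : Set E} (hb : Bornology.IsBounded D)
    (hD : ¬ IsRelWeaklyCompact D) :
    ∃ θ : ℝ, 0 < θ ∧ ∀ N : ℕ, ∃ (x : ℕ → E) (g : ℕ → StrongDual ℝ E), (∀ i < N, x i ∈ D) ∧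
      (∀ k < N, ‖g k‖ ≤ 1) ∧ ∀ i < N, ∀ k ≤ i, ∀ j < k, g k (x j) + θ ≤ g k (x i) := by
  obtain ⟨Φ, d, hd, hΦ, happ⟩ := exists_dual_not_mem_range hb hD
  refine ⟨d / 2, half_pos hd, fun N => ?_⟩
  -- The added strict inequality at `Φ` lets the next point be chosen weak* close to `Φ`.
  suffices h : ∃ (x : ℕ → E) (g : ℕ → StrongDual ℝ E), (∀ i < N, x i ∈ D) ∧
      (∀ k < N, ‖g k‖ ≤ 1) ∧ (∀ k < N, ∀ j < k, g k (x j) + d / 2 < Φ (g k)) ∧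
      ∀ i < N, ∀ k ≤ i, ∀ j < k, g k (x j) + d / 2 ≤ g k (x i) by
    obtain ⟨x, g, h1, h2, -, h3⟩ := h
    exact ⟨x, g, h1, h2, h3⟩
  induction N with
  | zero => exact ⟨0, 0, by simp, by simp, by simp, by simp⟩
  | succ N ih =>
    obtain ⟨x, g, h1, h2, h3, h4⟩ := ih
    obtain ⟨g', hg', hg'x⟩ := exists_dual_separating hΦ (half_pos hd).le (half_lt_self hd)
      (fun j : Fin N => x j)
    have hG : ∀ k < N + 1, ∀ j < k, Function.update g N g' k (x j) + d / 2 <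
        Φ (Function.update g N g' k) := by
      intro k hk j hj
      rcases Nat.lt_succ_iff_lt_or_eq.1 hk with hk | rfl
      · rw [Function.update_of_ne hk.ne]
        exact h3 k hk j hj
      · rw [Function.update_self]
        exact hg'x ⟨j, hj⟩
    set G := Function.update g N g' with hGdef
    have hx' : ∃ x' ∈ D, ∀ k < N + 1, ∀ j < k, G k (x j) + d / 2 < G k x' := by
      have hfin : {p : ℕ × ℕ | p.1 < N + 1 ∧ p.2 < p.1}.Finite :=
        ((Set.finite_lt_nat (N + 1)).prod (Set.finite_lt_nat (N + 1))).subset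
          fun p hp => ⟨hp.1, hp.2.trans hp.1⟩
      obtain ⟨x', hx'D, hx'⟩ := happ _ (hfin.image fun p => (G p.1, G p.1 (x p.2) + d / 2)) (by
        rintro _ ⟨p, hp, rfl⟩
        exact hG p.1 hp.1 p.2 hp.2)
      exact ⟨x', hx'D, fun k hk j hj => hx' _ ⟨(k, j), ⟨hk, hj⟩, rfl⟩⟩
    obtain ⟨x', hx'D, hx'⟩ := hx'
    refine ⟨Function.update x N x', G, fun i hi => ?_, fun k hk => ?_, fun k hk j hj => ?_,
      fun i hi k hk j hj => ?_⟩
    · rcases Nat.lt_succ_iff_lt_or_eq.1 hi with hi | rfl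
      · rw [Function.update_of_ne hi.ne]
        exact h1 i hi
      · rwa [Function.update_self]
    · rcases Nat.lt_succ_iff_lt_or_eq.1 hk with hk | rfl
      · rw [hGdef, Function.update_of_ne hk.ne]
        exact h2 k hk
      · rwa [hGdef, Function.update_self]
    · rw [Function.update_of_ne (by omega)]
      exact hG k hk j hj
    · rw [Function.update_of_ne (show j ≠ N by omega)]
      rcases Nat.lt_succ_iff_lt_or_eq.1 hi with hi | rfl
      · rw [Function.update_of_ne hi.ne, hGdef, Function.update_of_ne (by omega)]
        exact h4 i hi k hk j hj
      · rw [Function.update_self]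
        exact (hx' k (by omega) j hj).le

end WeakTopology

/-! ### Convex combinations and distances of hulls -/

section ConvexCombinations

variable {E : Type*} [NormedAddCommGroup E] [NormedSpace ℝ E]

lemma exists_mem_stdSimplex_of_mem_convexHull_range {ι : Type*} [Fintype ι] {v : ι → E} {y : E}
    (hy : y ∈ convexHull ℝ (Set.range v)) : ∃ w ∈ stdSimplex ℝ ι, ∑ j, w j • v j = y := by
  classical
  have hconv := (convex_stdSimplex ℝ ι).linear_image (Fintype.linearCombination ℝ v)
  refine convexHull_min ?_ hconv hy
  rintro _ ⟨j, rfl⟩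
  exact ⟨Pi.single j 1, single_mem_stdSimplex ℝ j, by
    simp [Fintype.linearCombination_apply_single]⟩

lemma le_dist_convexHull_of_dual {A B : Set E} {θ : ℝ} {g : StrongDual ℝ E} (hg : ‖g‖ ≤ 1)
    (h : ∀ a ∈ A, ∀ b ∈ B, g a + θ ≤ g b) :
    ∀ y ∈ convexHull ℝ A, ∀ z ∈ convexHull ℝ B, θ ≤ dist y z := by
  intro y hy z hz
  have h1 : ∀ b ∈ B, g y ≤ g b - θ := fun b hb =>
    convexHull_min (t := {y | g y ≤ g b - θ}) (fun a ha => le_sub_iff_add_le.2 (h a ha b hb))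
      (convex_halfSpace_le g.isLinear _) hy
  have h2 : g y + θ ≤ g z :=
    convexHull_min (t := {z | g y + θ ≤ g z}) (fun b hb => le_sub_iff_add_le.1 (h1 b hb))
      (convex_halfSpace_ge g.isLinear _) hz
  have h3 := g.le_of_opNorm_le hg (z - y)
  rw [map_sub, one_mul] at h3
  rw [dist_comm, dist_eq_norm]
  linarith [Real.le_norm_self (g z - g y)]

lemma le_norm_sum_smul_of_dual {ι : Type*} [Fintype ι] {v : ι → E} {θ : ℝ} {g : StrongDual ℝ E}
    (hg : ‖g‖ ≤ 1) (h : ∀ j, θ ≤ g (v j)) {w : ι → ℝ} (hw : w ∈ stdSimplex ℝ ι) :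
    θ ≤ ‖∑ j, w j • v j‖ := by
  have h1 : θ ≤ g (∑ j, w j • v j) := by
    rw [map_sum, ← one_mul θ, ← hw.2, Finset.sum_mul]
    refine Finset.sum_le_sum fun j _ => ?_
    rw [map_smul, smul_eq_mul]
    exact mul_le_mul_of_nonneg_left (h j) (hw.1 j)
  have h2 := g.le_of_opNorm_le hg (∑ j, w j • v j)
  rw [one_mul] at h2
  exact h1.trans ((Real.le_norm_self _).trans h2)

lemma le_setDist_iff {M : Type*} [PseudoMetricSpace M] {A B : Set M} (hA : A.Nonempty)
    (hB : B.Nonempty) {θ : ℝ} : θ ≤ setDist A B ↔ ∀ y ∈ A, ∀ z ∈ B, θ ≤ dist y z := by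
  rw [setDist, le_csInf_iff ⟨0, by rintro _ ⟨y, -, z, -, rfl⟩; exact dist_nonneg⟩ (hA.image2 hB)]
  simp only [Set.forall_mem_image2]

end ConvexCombinations

/-! ### Lexicographic order on the cube -/

section Cubes

lemma subcube_nonempty {n : ℕ} (k : Fin n) (a : Fin k → Bool) (ε : Bool) :
    (subcube k a ε).Nonempty := by
  refine ⟨fun j => if h : j.1 < k.1 then a ⟨j, h⟩ else ε, fun j => ?_, ?_⟩
  · simp
  · simp

lemma toLex_lt_of_mem_subcube {n : ℕ} {k : Fin n} {a : Fin k → Bool} {b c : Fin n → Bool}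
    (hb : b ∈ subcube k a false) (hc : c ∈ subcube k a true) : toLex b < toLex c := by
  refine ⟨k, fun j hj => ?_, ?_⟩
  · exact (hb.1 ⟨j, hj⟩).trans (hc.1 ⟨j, hj⟩).symm
  · change b k < c k
    rw [hb.2, hc.2]
    decide

variable {X : Type*} [NormedAddCommGroup X] [NormedSpace ℝ X]

lemma exists_cube_of_sequence {C : Set X} {θ : ℝ} (n : ℕ) {x : ℕ → X} (hx : ∀ i < 2 ^ n, x i ∈ C)
    (h : ∀ k < 2 ^ n, ∀ y ∈ convexHull ℝ (x '' {j | j < k}),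
      ∀ z ∈ convexHull ℝ (x '' {j | k ≤ j ∧ j < 2 ^ n}), θ ≤ dist y z) :
    ∃ f : (Fin n → Bool) → X, (∀ a, f a ∈ C) ∧
      ∀ (k : Fin n) (a : Fin k → Bool),
        θ ≤ setDist (convexHull ℝ (f '' subcube k a false))
          (convexHull ℝ (f '' subcube k a true)) := by
  let e : Lex (Fin n → Bool) ≃o Fin (2 ^ n) := (Fintype.orderIsoFinOfCardEq _ (by
    rw [Fintype.card_lex]; simp)).symm
  refine ⟨fun b => x (e (toLex b)), fun a => hx _ (e (toLex a)).2, fun k a => ?_⟩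
  rw [le_setDist_iff ((subcube_nonempty k a false).image _).convexHull
    ((subcube_nonempty k a true).image _).convexHull]
  -- The least point of the upper subcube is the cut: the lower subcube lies strictly before it.
  obtain ⟨c, hc, hmin⟩ := Set.exists_min_image (subcube k a true) (fun b => e (toLex b))
    (Set.toFinite _) (subcube_nonempty k a true)
  intro y hy z hz
  refine h (e (toLex c)) (e (toLex c)).2 y (convexHull_mono ?_ hy) z (convexHull_mono ?_ hz)
  · rintro _ ⟨b, hb, rfl⟩
    exact ⟨_, e.lt_iff_lt.2 (toLex_lt_of_mem_subcube hb hc), rfl⟩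
  · rintro _ ⟨b, hb, rfl⟩
    exact ⟨_, ⟨hmin b hb, (e (toLex b)).2⟩, rfl⟩

end Cubes

/-! ### Norm estimates in the ultrapower -/

section UltrapowerNorm

variable {I : Type w} (U : Ultrafilter I) {X : Type u} [NormedAddCommGroup X] [NormedSpace ℝ X]

lemma le_norm_mkQ_of_eventually {x : lp (fun _ : I => X) ⊤} {c : ℝ}
    (h : ∀ᶠ i in (U : Filter I), c ≤ ‖x i‖) : c ≤ ‖(ultraNull U X).mkQ x‖ := by
  refine le_of_forall_pos_lt_add fun ε hε => ?_
  obtain ⟨y, hy, hyx⟩ := Submodule.Quotient.norm_mk_lt ((ultraNull U X).mkQ x) (half_pos hε)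
  have hnull : y - x ∈ ultraNull U X := (Submodule.Quotient.eq _).1 hy
  have hev := (show Tendsto (fun i => ‖(y - x) i‖) (U : Filter I) (𝓝 0) from hnull).eventually
    (gt_mem_nhds (half_pos hε))
  obtain ⟨i, h1, h2⟩ := (h.and hev).exists
  have h3 : ‖y i‖ ≤ ‖y‖ := lp.norm_apply_le_norm ENNReal.top_ne_zero y i
  have h4 : ‖x i‖ ≤ ‖y i‖ + ‖(y - x) i‖ := by
    have := norm_sub_le (y i) ((y - x) i)
    simpa using this
  linarith

lemma norm_mkQ_le_of_eventually {x : lp (fun _ : I => X) ⊤} {c : ℝ} (hc : 0 ≤ c)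
    (h : ∀ᶠ i in (U : Filter I), ‖x i‖ ≤ c) : ‖(ultraNull U X).mkQ x‖ ≤ c := by
  classical
  -- Zeroing the exceptional coordinates leaves the class unchanged.
  let y : I → X := fun i => if ‖x i‖ ≤ c then x i else 0
  have hy : ∀ i, ‖y i‖ ≤ c := fun i => by
    by_cases hi : ‖x i‖ ≤ c
    · simp [y, hi]
    · simp [y, hi, hc]
  let y' : lp (fun _ : I => X) ⊤ := ⟨y, memℓp_infty ⟨c, by rintro _ ⟨i, rfl⟩; exact hy i⟩⟩
  have hxy : (ultraNull U X).mkQ x = (ultraNull U X).mkQ y' := by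
    refine (Submodule.Quotient.eq _).2 ?_
    refine tendsto_const_nhds.congr' (h.mono fun i hi => ?_)
    change 0 = ‖x i - y i‖
    simp [y, hi]
  rw [hxy]
  exact (Submodule.Quotient.norm_mk_le _ _).trans (lp.norm_le_of_forall_le hc hy)

/-- Finitely many vectors of the ultrapower whose convex combinations are bounded away from zero
are represented by families with the same property at almost all coordinates. -/
lemma eventually_forall_le_norm_sum_smul {ι : Type*} [Fintype ι]
    (d : ι → lp (fun _ : I => X) ⊤) {θ : ℝ} (hθ : 0 < θ)
    (h : ∀ w ∈ stdSimplex ℝ ι, θ ≤ ‖∑ j, w j • (ultraNull U X).mkQ (d j)‖) :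
    ∀ᶠ i in (U : Filter I), ∀ w ∈ stdSimplex ℝ ι, θ / 2 ≤ ‖∑ j, w j • d j i‖ := by
  by_contra hcon
  rw [← Ultrafilter.eventually_not] at hcon
  push Not at hcon
  have hch : ∀ i, ∃ w : ι → ℝ, (∃ w ∈ stdSimplex ℝ ι, ‖∑ j, w j • d j i‖ < θ / 2) →
      w ∈ stdSimplex ℝ ι ∧ ‖∑ j, w j • d j i‖ < θ / 2 := by
    intro i
    by_cases hi : ∃ w ∈ stdSimplex ℝ ι, ‖∑ j, w j • d j i‖ < θ / 2
    · obtain ⟨w, hw⟩ := hi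
      exact ⟨w, fun _ => hw⟩
    · exact ⟨0, fun h => absurd h hi⟩
  choose W hW using hch
  -- The limit of the bad weights gives a combination of norm at most `θ / 2 + θ / 4 < θ` in the
  -- ultrapower.
  obtain ⟨w, hw, hlim⟩ := (isCompact_stdSimplex ℝ ι).ultrafilter_le_nhds' (U.map W)
    (hcon.mono fun i hi => (hW i hi).1)
  have hlim : Tendsto W (U : Filter I) (𝓝 w) := hlim
  have herr : Tendsto (fun i => ∑ j, ‖w j - W i j‖ * ‖d j‖) (U : Filter I) (𝓝 0) := by
    have : Tendsto (fun i => ∑ j, ‖w j - W i j‖ * ‖d j‖) (U : Filter I)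
        (𝓝 (∑ j, ‖w j - w j‖ * ‖d j‖)) :=
      tendsto_finsetSum _ fun j _ =>
        ((tendsto_const_nhds.sub ((tendsto_pi_nhds.1 hlim) j)).norm).mul_const _
    simpa using this
  have hle : ∀ᶠ i in (U : Filter I), ‖(∑ j, w j • d j) i‖ ≤ θ / 2 + θ / 4 := by
    filter_upwards [hcon, herr.eventually (gt_mem_nhds (by positivity : 0 < θ / 4))] with i hi hie
    have h1 : (∑ j, w j • d j) i = ∑ j, W i j • d j i + ∑ j, (w j - W i j) • d j i := by
      rw [← Finset.sum_add_distrib, lp.coeFn_sum, Finset.sum_apply]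
      exact Finset.sum_congr rfl fun j _ => by rw [← add_smul, add_sub_cancel]; rfl
    rw [h1]
    refine (norm_add_le _ _).trans (add_le_add (hW i hi).2.le (le_trans ?_ hie.le))
    refine (norm_sum_le _ _).trans (Finset.sum_le_sum fun j _ => ?_)
    rw [norm_smul]
    exact mul_le_mul_of_nonneg_left (lp.norm_apply_le_norm ENNReal.top_ne_zero _ _) (norm_nonneg _)
  have h2 := norm_mkQ_le_of_eventually U (by positivity) hle
  rw [map_sum] at h2
  simp only [map_smul] at h2
  linarith [h w hw]

end UltrapowerNorm

/-! ### Transfer between `C` and its ultrapowers -/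

section Main

variable {X : Type u} [NormedAddCommGroup X] [NormedSpace ℝ X]

lemma exists_cube_of_not_bddAbove {C : Set X} {g : StrongDual ℝ X} (hg : ¬ BddAbove (g '' C))
    (n : ℕ) : ∃ f : (Fin n → Bool) → X, (∀ a, f a ∈ C) ∧
      ∀ (k : Fin n) (a : Fin k → Bool),
        1 ≤ setDist (convexHull ℝ (f '' subcube k a false))
          (convexHull ℝ (f '' subcube k a true)) := by
  have hlarge : ∀ r : ℝ, ∃ x ∈ C, r ≤ g x := fun r => by
    obtain ⟨_, ⟨x, hx, rfl⟩, hr⟩ := not_bddAbove_iff.1 hg r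
    exact ⟨x, hx, hr.le⟩
  choose next hnextC hnext using hlarge
  -- After division by `c`, the functional has norm at most `1` and gaps at least `1`.
  let c : ℝ := max ‖g‖ 1
  have hc : 0 < c := lt_max_of_lt_right one_pos
  let x : ℕ → X := fun n => Nat.rec (next 0) (fun _ y => next (g y + c)) n
  have hxC : ∀ i, x i ∈ C := fun i => by cases i <;> exact hnextC _
  have hstep : ∀ i, g (x i) + c ≤ g (x (i + 1)) := fun i => hnext _
  have hmono : Monotone fun i => g (x i) :=
    monotone_nat_of_le_succ fun i => by linarith [hstep i]
  refine exists_cube_of_sequence n (fun i _ => hxC i) fun k _ => ?_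
  refine le_dist_convexHull_of_dual (g := c⁻¹ • g) ?_ ?_
  · rw [norm_smul, Real.norm_eq_abs, abs_of_pos (inv_pos.2 hc)]
    exact (inv_mul_le_one₀ hc).2 (le_max_left _ _)
  · rintro _ ⟨j, hj, rfl⟩ _ ⟨i, hi, rfl⟩
    have h1 := (hstep j).trans (hmono (show j + 1 ≤ i from lt_of_lt_of_le hj hi.1))
    have h2 := mul_le_mul_of_nonneg_left h1 (inv_pos.2 hc).le
    rw [mul_add, inv_mul_cancel₀ hc.ne'] at h2
    exact h2

lemma isBounded_of_isBounded_ultrapowerSet {I : Type w} (U : Ultrafilter I) {C : Set X}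
    (h : Bornology.IsBounded (ultrapowerSet U C)) : Bornology.IsBounded C := by
  obtain ⟨c, hc⟩ := isBounded_iff_forall_norm_le.1 h
  refine isBounded_iff_forall_norm_le.2 ⟨c, fun x hx => ?_⟩
  let y : lp (fun _ : I => X) ⊤ := ⟨fun _ => x, memℓp_infty ⟨‖x‖, by rintro _ ⟨i, rfl⟩; exact le_rfl⟩⟩
  exact (le_norm_mkQ_of_eventually U (x := y) (Eventually.of_forall fun i => le_rfl)).trans
    (hc _ ⟨y, fun _ => hx, rfl⟩)

lemma isBounded_ultrapowerSet {I : Type w} (U : Ultrafilter I) {C : Set X}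
    (h : Bornology.IsBounded C) : Bornology.IsBounded (ultrapowerSet U C) := by
  obtain ⟨c, hc⟩ := isBounded_iff_forall_norm_le.1 h
  refine isBounded_iff_forall_norm_le.2 ⟨max c 0, ?_⟩
  rintro _ ⟨x, hx, rfl⟩
  exact norm_mkQ_le_of_eventually U (le_max_right _ _)
    (Eventually.of_forall fun i => (hc _ (hx i)).trans (le_max_left _ _))

lemma exists_cube_of_ultrapowerSet [CompleteSpace X] {I : Type w} (U : Ultrafilter I) {C : Set X}
    (hb : Bornology.IsBounded C) (hC : ¬ IsRelWeaklyCompact (ultrapowerSet U C)) :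
    ∃ θ : ℝ, 0 < θ ∧ ∀ n : ℕ, ∃ f : (Fin n → Bool) → X, (∀ a, f a ∈ C) ∧
      ∀ (k : Fin n) (a : Fin k → Bool),
        θ ≤ setDist (convexHull ℝ (f '' subcube k a false))
          (convexHull ℝ (f '' subcube k a true)) := by
  classical
  obtain ⟨θ, hθ, hseq⟩ := exists_separated_sequence (isBounded_ultrapowerSet U hb) hC
  refine ⟨θ / 2, half_pos hθ, fun n => ?_⟩
  obtain ⟨x, g, hx, hg, hxg⟩ := hseq (2 ^ n)
  have hrep : ∀ i, ∃ r : lp (fun _ : I => X) ⊤, i < 2 ^ n →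
      (∀ l, r l ∈ C) ∧ (ultraNull U X).mkQ r = x i := fun i => by
    by_cases hi : i < 2 ^ n
    · obtain ⟨r, hr, hrx⟩ := hx i hi
      exact ⟨r, fun _ => ⟨hr, hrx⟩⟩
    · exact ⟨0, fun h => absurd h hi⟩
  choose r hr using hrep
  -- A difference of hulls is the hull of the differences, so each cut needs only one finite family.
  let ι : ℕ → Type := fun k => {p : Fin (2 ^ n) × Fin (2 ^ n) // p.1.1 < k ∧ k ≤ p.2.1}
  have hev : ∀ k : Fin (2 ^ n), ∀ᶠ l in (U : Filter I), ∀ w ∈ stdSimplex ℝ (ι k),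
      θ / 2 ≤ ‖∑ p, w p • (r p.1.2 - r p.1.1) l‖ := by
    intro k
    refine eventually_forall_le_norm_sum_smul U (fun p : ι k => r p.1.2 - r p.1.1) hθ
      fun w hw => le_norm_sum_smul_of_dual (hg k k.2) (fun p => ?_) hw
    rw [map_sub, (hr _ p.1.1.2).2, (hr _ p.1.2.2).2, map_sub]
    linarith [hxg p.1.2 p.1.2.2 k p.2.2 p.1.1 p.2.1]
  obtain ⟨l, hl⟩ := (eventually_all.2 hev).exists
  refine exists_cube_of_sequence n (x := fun i => r i l) (fun i hi => (hr i hi).1 l)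
    fun k hk y hy z hz => ?_
  have hzy : z - y ∈ convexHull ℝ (Set.range fun p : ι k => (r p.1.2 - r p.1.1) l) := by
    have := Set.sub_mem_sub hz hy
    rw [← convexHull_sub] at this
    refine convexHull_mono ?_ this
    rintro _ ⟨_, ⟨i, hi, rfl⟩, _, ⟨j, hj, rfl⟩, rfl⟩
    exact ⟨⟨(⟨j, lt_trans hj hk⟩, ⟨i, hi.2⟩), hj, hi.1⟩, rfl⟩
  obtain ⟨w, hw, hwzy⟩ := exists_mem_stdSimplex_of_mem_convexHull_range hzy
  rw [dist_comm, dist_eq_norm, ← hwzy]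
  exact hl ⟨k, hk⟩ w hw

lemma not_isRelWeaklyCompact_ultrapowerSet_of_cubes {I : Type w} (U : Ultrafilter I) (m : I → ℕ)
    (hm : Tendsto m U atTop) {C : Set X} (hb : Bornology.IsBounded C) {θ : ℝ} (hθ : 0 < θ)
    (hcube : ∀ n : ℕ, ∃ f : (Fin n → Bool) → X, (∀ a, f a ∈ C) ∧
      ∀ (k : Fin n) (a : Fin k → Bool),
        θ ≤ setDist (convexHull ℝ (f '' subcube k a false))
          (convexHull ℝ (f '' subcube k a true))) :
    ¬ IsRelWeaklyCompact (ultrapowerSet U C) := by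
  classical
  choose f hfC hf using hcube
  obtain ⟨c, hc⟩ := isBounded_iff_forall_norm_le.1 hb
  let G : Set ℕ → lp (fun _ : I => X) ⊤ := fun b =>
    ⟨fun i => f (m i) fun j => decide (j.1 ∈ b),
      memℓp_infty ⟨c, by rintro _ ⟨i, rfl⟩; exact hc _ (hfC _ _)⟩⟩
  refine not_isRelWeaklyCompact_of_tree hθ (F := fun b => (ultraNull U X).mkQ (G b))
    (fun b => ⟨G b, fun i => hfC _ _, rfl⟩) fun k s => ?_
  have hlift : ∀ (A : Set (Set ℕ)), ∀ y ∈ convexHull ℝ ((fun b => (ultraNull U X).mkQ (G b)) '' A),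
      ∃ y' ∈ convexHull ℝ (G '' A), (ultraNull U X).mkQ y' = y := by
    intro A y hy
    rw [show (fun b => (ultraNull U X).mkQ (G b)) '' A = (ultraNull U X).mkQ '' (G '' A) from
      (Set.image_image _ _ _).symm, ← LinearMap.image_convexHull] at hy
    exact hy
  have hcoord : ∀ (A : Set (Set ℕ)) (i : I) (B : Set (Fin (m i) → Bool)),
      (∀ b ∈ A, (fun j : Fin (m i) => decide (j.1 ∈ b)) ∈ B) → ∀ y ∈ convexHull ℝ (G '' A),
      y i ∈ convexHull ℝ (f (m i) '' B) := by
    intro A i B hAB y hy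
    have hlin : IsLinearMap ℝ fun y : lp (fun _ : I => X) ⊤ => y i := ⟨fun _ _ => rfl, fun _ _ => rfl⟩
    refine convexHull_min (t := {y : lp (fun _ : I => X) ⊤ | y i ∈ convexHull ℝ (f (m i) '' B)})
      ?_ ((convex_convexHull ℝ _).is_linear_preimage hlin) hy
    rintro _ ⟨b, hb, rfl⟩
    exact subset_convexHull ℝ _ ⟨_, hAB b hb, rfl⟩
  intro y hy z hz
  obtain ⟨y, hy', rfl⟩ := hlift _ y hy
  obtain ⟨z, hz', rfl⟩ := hlift _ z hz
  rw [dist_eq_norm, ← map_sub]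
  -- Level `k` exists in the cube of dimension `m i` only if `k < m i`, which holds for almost all
  -- `i`.
  refine le_norm_mkQ_of_eventually U ((hm.eventually (eventually_gt_atTop k)).mono fun i hi => ?_)
  have h := (le_setDist_iff ((subcube_nonempty _ _ _).image _).convexHull
    ((subcube_nonempty _ _ _).image _).convexHull).1
    (hf (m i) ⟨k, hi⟩ fun j => decide (j.1 ∈ s)) (y i) (hcoord _ i _ (fun b hb => ?_) y hy')
    (z i) (hcoord _ i _ (fun b hb => ?_) z hz')
  · rwa [dist_eq_norm] at h
  · exact ⟨fun j => decide_eq_decide.2 (hb.1 j j.2), decide_eq_false hb.2⟩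
  · exact ⟨fun j => decide_eq_decide.2 (hb.1 j j.2), decide_eq_true hb.2⟩

end Main

theorem theorem3p6 {X : Type u} [NormedAddCommGroup X] [NormedSpace ℝ X] [CompleteSpace X]
    (C : Set X) :
    ¬ IsRelSuperWeaklyCompact.{u, w} C ↔
      ∃ θ : ℝ, 0 < θ ∧ ∀ n : ℕ, ∃ f : (Fin n → Bool) → X, (∀ a, f a ∈ C) ∧
        ∀ (k : Fin n) (a : Fin k → Bool),
          θ ≤ setDist (convexHull ℝ (f '' subcube k a false))
            (convexHull ℝ (f '' subcube k a true)) := by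
  constructor
  · intro h
    by_cases hb : ∀ g : StrongDual ℝ X, BddAbove (g '' C)
    · simp only [IsRelSuperWeaklyCompact, not_forall] at h
      obtain ⟨I, U, -, hU⟩ := h
      exact exists_cube_of_ultrapowerSet U (isBounded_of_forall_dual hb) hU
    · obtain ⟨g, hg⟩ := not_forall.1 hb
      exact ⟨1, one_pos, exists_cube_of_not_bddAbove hg⟩
  · rintro ⟨θ, hθ, hcube⟩ h
    -- `ULift` places the index set in universe `w`; the assumed compactness also yields the
    -- boundedness of `C`.
    have hfree := hyperfilter_le_cofinite (α := ULift.{w} ℕ)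
    have hU := h (ULift.{w} ℕ) (hyperfilter _) hfree
    refine not_isRelWeaklyCompact_ultrapowerSet_of_cubes _ ULift.down ?_
      (isBounded_of_isBounded_ultrapowerSet _ hU.isBounded) hθ hcube hU
    rw [← Nat.cofinite_eq_atTop]
    exact ULift.down_injective.tendsto_cofinite.mono_left hfree
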